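/- **Setting.** A contextual MDP (CMDP) with horizon $H$, finite context space $\mathcal C$, finite state space $\mathcal S$, finite action space $\mathcal A$ and fixed starting state $s^1\in\mathcal S$ is given by transition kernels $P_M^h(\cdot\mid s,a;c)\in\Delta(\mathcal S)$ for $h\in[H]$, $c\in\mathcal C$, $s\in\mathcal S$, $a\in\mathcal A$; all models $M$ of a class have reward identically $0$. A policy is $\pi=(\pi^1,\dots,\pi^H)$ with $\pi^h:\mathcal S\to\Delta(\mathcal A)$. A reward distribution $R$ assigns to each $(c,h,s,a)$ a law $R^h(s,a;c)\in\Delta([0,1])$, such that along every sequence of states and actions the total reward $\sum_{h=1}^H r^h$ is at most $1$ almost surely. $V_M(\pi,c,R)$ denotes the expected total reward of $\pi$, started from $s^1$ under context $c$, when the transitions are those of $M$ and the rewards are drawn from $R$. Let $\mathcal D$ be a distribution on $\mathcal C$. An algorithm (adaptive, possibly randomized) interacts with an unknown $M\in\mathcal M$ without observing rewards. In each round it decides, from its past observations, whether to stop; if not, a context $c\sim\mathcal D$ is drawn independently and shown, the algorithm chooses a policy, and it observes one trajectory $(s^1,a^1,\dots,s^H,a^H)$ of this policy in $M(c)$. When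 it stops, it outputs a model $\widehat M$ (not necessarily in $\mathcal M$). Let $T\in\mathbb N\cup\{\infty\}$ be the number of trajectories collected, and let $\mathbb E_{M,\mathsf{Alg}}$ be the expectation under the interaction with $M$. The algorithm $(\varepsilon,\delta)$-learns $\mathcal M$ if for each $M\in\mathcal M$, with probability at least $1-\delta$, it stops and its output satisfies $$\mathbb E_{c\sim\mathcal D}\bigl|V_M(\pi_c,c,R)-V_{\widehat M}(\pi_c,c,R)\bigr|\le\varepsilon\qquad\text{for all reward distributions } R \text{ and all families of policies } (\pi_c)_{c\in\mathcal C}.$$ **Theorem 6.2.** There are universal constants $L,\kappa>0$ and $K_0\in\mathbb N$ such that the following holds for all $0<\varepsilon\le1$, all $\delta\le1/2$, all integers $H,A\ge2$, all integers $S\ge L\log A$ and all integers $K\ge K_0$. There exist a finite context space $\mathcal C$ with a distribution $\mathcal D$, a class $\mathcal M$ of CMDPs over $\mathcal C$ with $|\mathcal S|=S$, $|\mathcal A|=A$, $|\mathcal M|=K$ and horizon $H$ (with a common starting state), and a distribution $\mu$ on $\mathcal M$, such that every algorithm $\mathsf{Alg}$ that $(\varepsilon/24,\delta)$-learns $\mathcal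 M$ satisfies $$\mathbb E_{M\sim\mu}\,\mathbb E_{M,\mathsf{Alg}}[T]\;\ge\;\kappa\,\frac{\log|\mathcal M|}{\varepsilon^2}.$$ The same $\mathcal M$ and $\mu$ give this bound also for every algorithm that $(\varepsilon/24,\delta)$-learns $\mathcal M$ when, in the definition of learning, $V_M(\pi,c,R)$ is replaced by $\max_{a\in\mathcal A}Q_M^1(s^1,a;\pi,c,R)$, where $Q_M^1(s^1,a;\pi,c,R)$ is the expected total reward when the first action is $a$ and $\pi$ is followed afterwards. -/

import Mathlib

open MeasureTheory
open scoped ENNReal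

noncomputable section

namespace CMDP

/-- The transition kernels `P^h(· | s, a; c)` of a contextual MDP with horizon `H`.  All models of a
reward-free class have reward identically `0`, so a model is its transition kernels; `M(·;R)` is the
pair of `M` and a reward distribution `R`. -/
abbrev Model (C 𝒮 𝒜 : Type) (H : ℕ) : Type := C → Fin H → 𝒮 → 𝒜 → PMF 𝒮

/-- Randomized, non-stationary (Markov) policies. -/
abbrev Policy (𝒮 𝒜 : Type) (H : ℕ) : Type := Fin H → 𝒮 → PMF 𝒜

/-- Trajectories `(s^1, a^1, …, s^H, a^H)`. The rewards are omitted: during the interaction they are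
all `0`. -/
abbrev Trajectory (𝒮 𝒜 : Type) (H : ℕ) : Type := Fin H → 𝒮 × 𝒜

/-- Reward distributions `R^h(s, a; c)`, probability measures on `[0,1]`. -/
abbrev Reward (C 𝒮 𝒜 : Type) (H : ℕ) : Type :=
  C → Fin H → 𝒮 → 𝒜 → ProbabilityMeasure unitInterval

/-- What has been seen after some number of rounds: the contexts and trajectories, in chronological
order. The number of trajectories is the length of the list. -/
abbrev History (C 𝒮 𝒜 : Type) (H : ℕ) : Type := List (C × Trajectory 𝒮 𝒜 H)

/-- Law of the trajectory that starts in the state `s`, when the transition kernels are `P` and the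
policy is `π`. -/
def trajLaw {𝒮 𝒜 : Type} : (H : ℕ) → (Fin H → 𝒮 → 𝒜 → PMF 𝒮) → Policy 𝒮 𝒜 H → 𝒮 →
    PMF (Trajectory 𝒮 𝒜 H)
  | 0, _, _, _ => PMF.pure Fin.elim0
  | H + 1, P, π, s =>
      (π 0 s).bind fun a =>
        (P 0 s a).bind fun s' =>
          (trajLaw H (fun h => P h.succ) (fun h => π h.succ) s').map fun τ => Fin.cons (s, a) τ

variable {C 𝒮 𝒜 : Type} {H : ℕ}

/-- The total reward is at most `1` almost surely, along every sequence of states and actions.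
(It is nonnegative because rewards lie in `[0,1]`.) -/
def Reward.Normalized (R : Reward C 𝒮 𝒜 H) : Prop :=
  ∀ (c : C) (τ : Trajectory 𝒮 𝒜 H),
    ∀ᵐ r ∂(Measure.pi fun h => (R c h (τ h).1 (τ h).2 : Measure unitInterval)),
      ∑ h, (r h : ℝ) ≤ 1

/-- Mean of the reward distribution `R^h(s, a; c)`. -/
def Reward.mean (R : Reward C 𝒮 𝒜 H) (c : C) (h : Fin H) (s : 𝒮) (a : 𝒜) : ℝ :=
  ∫ r, (r : ℝ) ∂(R c h s a : Measure unitInterval)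

/-- The value `V_M(π, c, R)`: the expected total reward of `π` in `M(·;R)` under the context `c`,
from the starting state `s₁`. -/
def value [Fintype 𝒮] [Fintype 𝒜] (s₁ : 𝒮) (M : Model C 𝒮 𝒜 H) (π : Policy 𝒮 𝒜 H) (c : C)
    (R : Reward C 𝒮 𝒜 H) : ℝ :=
  ∑ τ : Trajectory 𝒮 𝒜 H,
    (trajLaw H (M c) π s₁ τ).toReal * ∑ h, R.mean c h (τ h).1 (τ h).2

/-- The policy that plays `a` in the first layer and follows `π` afterwards. -/
def Policy.forceFirst (π : Policy 𝒮 𝒜 H) (a : 𝒜) : Policy 𝒮 𝒜 H :=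
  fun h s => if h.val = 0 then PMF.pure a else π h s

/-- `max_a Q^1(s₁, a; π, c, R)`, where `Q^1(s₁, a; π, c, R)` is the expected total reward when the
first action is `a` and `π` is followed afterwards. -/
def maxValue [Fintype 𝒮] [Fintype 𝒜] (s₁ : 𝒮) (M : Model C 𝒮 𝒜 H) (π : Policy 𝒮 𝒜 H) (c : C)
    (R : Reward C 𝒮 𝒜 H) : ℝ :=
  ⨆ a : 𝒜, value s₁ M (π.forceFirst a) c R

/-- The prediction `M'` is `ε`-accurate for the model `M`, with respect to the value function `V`:
for every reward distribution and every family of policies indexed by the contexts,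
`E_{c ∼ D} |V_M(π_c, c, R) - V_{M'}(π_c, c, R)| ≤ ε`. -/
def Accurate [Fintype C] (D : PMF C)
    (V : Model C 𝒮 𝒜 H → Policy 𝒮 𝒜 H → C → Reward C 𝒮 𝒜 H → ℝ) (ε : ℝ)
    (M M' : Model C 𝒮 𝒜 H) : Prop :=
  ∀ R : Reward C 𝒮 𝒜 H, R.Normalized → ∀ π : C → Policy 𝒮 𝒜 H,
    ∑ c, (D c).toReal * |V M (π c) c R - V M' (π c) c R| ≤ ε

/-- A randomized, adaptive learning algorithm. Its internal randomness is a seed, drawn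
independently of the environment. Given the history it decides whether to stop; if it does not
stop, it sees the context of the next round and chooses a policy. When it stops it outputs a model,
which need not belong to any class. -/
structure Algorithm (C 𝒮 𝒜 : Type) (H : ℕ) where
  Seed : Type
  [measurableSpace : MeasurableSpace Seed]
  seedLaw : Measure Seed
  [isProbabilityMeasure : IsProbabilityMeasure seedLaw]
  halt : Seed → History C 𝒮 𝒜 H → Bool
  policy : Seed → History C 𝒮 𝒜 H → C → Policy 𝒮 𝒜 H
  output : Seed → History C 𝒮 𝒜 H → Model C 𝒮 𝒜 H
  measurable_halt : ∀ x, Measurable fun ω => halt ω x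
  measurable_policy : ∀ x c h s a, Measurable fun ω => policy ω x c h s a
  measurable_output : ∀ x c h s a s', Measurable fun ω => output ω x c h s a s'

namespace Algorithm

attribute [instance] Algorithm.measurableSpace Algorithm.isProbabilityMeasure

variable (Alg : Algorithm C 𝒮 𝒜 H) (D : PMF C) (s₁ : 𝒮) (M : Model C 𝒮 𝒜 H)

/-- Law of the history after `t` rounds of interaction with the model `M`, given the seed `ω`; the
history no longer changes once the algorithm has stopped. -/
def run (ω : Alg.Seed) : ℕ → PMF (History C 𝒮 𝒜 H)
  | 0 => PMF.pure []
  | t + 1 => (run ω t).bind fun x =>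
      if Alg.halt ω x then PMF.pure x
      else D.bind fun c =>
        (trajLaw H (M c) (Alg.policy ω x c) s₁).map fun τ => x ++ [(c, τ)]

/-- The expected number `E_{M,Alg}[T]` of trajectories collected before stopping (possibly `∞`).
The length of the history after `t` rounds is `min T t`. -/
def expectedTrajectories : ℝ≥0∞ :=
  ∫⁻ ω, ⨆ t : ℕ, ∑' x, Alg.run D s₁ M ω t x * (x.length : ℝ≥0∞) ∂Alg.seedLaw

/-- The probability that the algorithm stops and that its output then satisfies `good`. -/
def outputProb (good : Model C 𝒮 𝒜 H → Prop) : ℝ≥0∞ :=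
  ∫⁻ ω, ⨆ t : ℕ, (Alg.run D s₁ M ω t).toOuterMeasure
    {x | Alg.halt ω x = true ∧ good (Alg.output ω x)} ∂Alg.seedLaw

/-- The algorithm `(ε, δ)`-learns the class `𝓜`, with respect to the value function `V`. -/
def Learns [Fintype C] (V : Model C 𝒮 𝒜 H → Policy 𝒮 𝒜 H → C → Reward C 𝒮 𝒜 H → ℝ)
    (ε δ : ℝ) (𝓜 : Finset (Model C 𝒮 𝒜 H)) : Prop :=
  ∀ M ∈ 𝓜, ENNReal.ofReal (1 - δ) ≤ Alg.outputProb D s₁ M (Accurate D V ε M)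

end Algorithm

end CMDP

end

/-! Take `n = Nat.log 2 K` equally likely contexts. In each context the second state is a coin flip
between `s₁` and `s₂`, whatever the actions, and `s₂` has probability `1/2 ± ε/4` with a sign
depending on the context. The `2 ^ n` sign vectors give the hard models and `μ` is uniform on them.
With reward `1` for being in `s₂` in the second layer, both value functions equal the bias under
every policy, so an accurate output estimates all biases within `ε/24` on average over the contexts.

Few sign vectors fit a given output: `sum_exp_close_le` proves this by an exponential-moment bound
that factorizes over contexts. One round carries little information: against the model with fair
coins, its relative entropy is at most `ε ^ 2 / 4` for every policy
(`sum_roundLaw_signModel_mul_log_le`).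

`sum_step_iterate_le` combines the two facts. For a likelihood ratio `l` and a test function `g`,
integrating `l * (g - log l) ≤ exp (g - 1)` under the reference law bounds the expectation of `g`
under each model by its relative entropy plus a reference term. The entropy is at most `ε ^ 2 / 4`
times the expected number of rounds, and the reference terms are summed over the sign vectors inside
one expectation. Taking `g` to be `n/3` on success yields `n/6 ≤ (ε ^ 2 / 4) * T + 1` for the
average `T` of the expected trajectory counts, which is the bound once `n ≥ 12`. -/

namespace CMDP

/-! ### Stopped sequential experiments: change of measure and Fano's inequality -/

/-- One round of a sequential experiment with outcomes in `Ω`, stopped by `halt`, acting on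
functions of the list of outcomes. -/
noncomputable def step {Ω : Type*} [Fintype Ω] (halt : List Ω → Bool) (w : List Ω → Ω → ℝ)
    (F : List Ω → ℝ) (x : List Ω) : ℝ :=
  if halt x then F x else ∑ o, w x o * F (x ++ [o])

section Step

variable {Ω : Type*} [Fintype Ω] {halt : List Ω → Bool} {w : List Ω → Ω → ℝ}

lemma step_mono (hw : ∀ x o, 0 ≤ w x o) : Monotone (step halt w) := by
  intro F G h x
  unfold step
  split_ifs
  · exact h x
  · exact Finset.sum_le_sum fun o _ => mul_le_mul_of_nonneg_left (h _) (hw x o)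

lemma step_iterate_mono (hw : ∀ x o, 0 ≤ w x o) (t : ℕ) {F G : List Ω → ℝ} (h : F ≤ G) :
    (step halt w)^[t] F ≤ (step halt w)^[t] G :=
  (step_mono hw).iterate t h

lemma step_add (F G : List Ω → ℝ) : step halt w (F + G) = step halt w F + step halt w G := by
  funext x
  simp only [step, Pi.add_apply]
  split_ifs
  · rfl
  · simp [mul_add, Finset.sum_add_distrib]

lemma step_smul (a : ℝ) (F : List Ω → ℝ) : step halt w (a • F) = a • step halt w F := by
  funext x
  simp only [step, Pi.smul_apply, smul_eq_mul]
  split_ifs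
  · rfl
  · rw [Finset.mul_sum]
    exact Finset.sum_congr rfl fun o _ => by ring

lemma step_iterate_add (t : ℕ) (F G : List Ω → ℝ) :
    (step halt w)^[t] (F + G) = (step halt w)^[t] F + (step halt w)^[t] G := by
  induction t generalizing F G with
  | zero => rfl
  | succ t ih => simp only [Function.iterate_succ_apply, step_add, ih]

lemma step_iterate_smul (t : ℕ) (a : ℝ) (F : List Ω → ℝ) :
    (step halt w)^[t] (a • F) = a • (step halt w)^[t] F := by
  induction t generalizing F with
  | zero => rfl
  | succ t ih => simp only [Function.iterate_succ_apply, step_smul, ih]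

lemma step_iterate_sub (t : ℕ) (F G : List Ω → ℝ) :
    (step halt w)^[t] (F - G) = (step halt w)^[t] F - (step halt w)^[t] G := by
  rw [eq_sub_iff_add_eq, ← step_iterate_add, sub_add_cancel]

lemma step_iterate_sum {ι : Type*} (s : Finset ι) (t : ℕ) (F : ι → List Ω → ℝ) :
    (step halt w)^[t] (∑ i ∈ s, F i) = ∑ i ∈ s, (step halt w)^[t] (F i) := by
  classical
  induction s using Finset.induction_on with
  | empty =>
    have := step_iterate_smul (halt := halt) (w := w) t 0 0
    simpa using this
  | insert a s ha ih => rw [Finset.sum_insert ha, Finset.sum_insert ha, step_iterate_add, ih]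

lemma step_iterate_nonneg (hw : ∀ x o, 0 ≤ w x o) (t : ℕ) {F : List Ω → ℝ} (h : ∀ x, 0 ≤ F x)
    (x : List Ω) : 0 ≤ (step halt w)^[t] F x := by
  have h0 : (step halt w)^[t] 0 = 0 := by
    simpa using step_iterate_smul (halt := halt) (w := w) t 0 0
  have := step_iterate_mono (halt := halt) hw t (F := 0) (G := F) h x
  rwa [h0] at this

lemma step_iterate_const (hw : ∀ x, ∑ o, w x o = 1) (t : ℕ) (b : ℝ) :
    (step halt w)^[t] (fun _ => b) = fun _ => b := by
  refine Function.iterate_fixed ?_ t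
  funext x
  simp only [step, ← Finset.sum_mul, hw, one_mul, ite_self]

/-- The expectation of a supermartingale does not increase with the number of rounds. -/
lemma step_iterate_le (hw : ∀ x o, 0 ≤ w x o) {F : List Ω → ℝ} (hF : step halt w F ≤ F) (t : ℕ) :
    (step halt w)^[t] F ≤ F := by
  induction t with
  | zero => exact le_rfl
  | succ t ih =>
    rw [Function.iterate_succ_apply]
    exact (step_iterate_mono hw t hF).trans ih

/-- Change of measure: the likelihood ratio of a list of outcomes is the product of the likelihood
ratios of its entries. -/
lemma prod_mul_step_iterate {w' : List Ω → Ω → ℝ} {r : Ω → ℝ} (hr : ∀ x o, w' x o = r o * w x o)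
    (t : ℕ) (F : List Ω → ℝ) :
    (fun x => (x.map r).prod * (step halt w')^[t] F x) =
      (step halt w)^[t] fun x => (x.map r).prod * F x := by
  induction t generalizing F with
  | zero => rfl
  | succ t ih =>
    rw [Function.iterate_succ_apply, Function.iterate_succ_apply, ih]
    congr 1
    funext x
    simp only [step]
    split_ifs
    · rfl
    · rw [Finset.mul_sum]
      refine Finset.sum_congr rfl fun o _ => ?_
      rw [hr, List.map_append, List.prod_append]
      simp
      ring

/-- The expected log-likelihood ratio is at most the expected number of rounds times the largest
expected log-likelihood ratio of one round. -/
lemma step_iterate_sum_log_le {r : Ω → ℝ} {κ : ℝ}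
    (hw : ∀ x o, 0 ≤ w x o) (hw1 : ∀ x, ∑ o, w x o = 1)
    (hκ : ∀ x, ∑ o, w x o * Real.log (r o) ≤ κ) (t : ℕ) :
    (step halt w)^[t] (fun x => (x.map fun o => Real.log (r o)).sum) [] ≤
      κ * (step halt w)^[t] (fun x => (x.length : ℝ)) [] := by
  -- The log-likelihood minus `κ` times the number of rounds is a supermartingale, and it vanishes
  -- on the empty list.
  have key : step halt w ((fun x => (x.map fun o => Real.log (r o)).sum) -
      κ • fun x => (x.length : ℝ)) ≤ (fun x => (x.map fun o => Real.log (r o)).sum) -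
      κ • fun x => (x.length : ℝ) := by
    intro x
    simp only [step]
    split_ifs
    · exact le_rfl
    · have : ∀ o, w x o * (((fun x => (x.map fun o => Real.log (r o)).sum) -
          κ • fun x => (x.length : ℝ) : List Ω → ℝ) (x ++ [o])) =
          w x o * ((x.map fun o => Real.log (r o)).sum - κ * (x.length + 1)) +
            w x o * Real.log (r o) := by
        intro o
        simp
        ring
      simp only [this, Finset.sum_add_distrib, ← Finset.sum_mul, hw1]
      simp only [Pi.sub_apply, Pi.smul_apply, smul_eq_mul]
      linarith [hκ x]
  have h := step_iterate_le hw key t []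
  rw [step_iterate_sub, step_iterate_smul] at h
  simpa using h

/-- This is `1 + u ≤ exp u` at `u = g - 1 - log l`, multiplied by `l`: Young's inequality for the
conjugate functions `l * log l` and `exp (g - 1)`. -/
lemma mul_sub_log_le {l g : ℝ} (hl : 0 < l) : l * (g - Real.log l) ≤ Real.exp (g - 1) := by
  have h := Real.add_one_le_exp (g - 1 - Real.log l)
  rw [Real.exp_sub, Real.exp_log hl, le_div_iff₀ hl] at h
  linarith

/-- Fano's inequality for a stopped sequential experiment: if no guess is good for many parameters,
then good guesses need many rounds. -/
theorem sum_step_iterate_le {ι : Type*} [Fintype ι] {w' : ι → List Ω → Ω → ℝ} {r : ι → Ω → ℝ}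
    {κ B : ℝ} (hw : ∀ x o, 0 ≤ w x o) (hw1 : ∀ x, ∑ o, w x o = 1)
    (hw' : ∀ i x, ∑ o, w' i x o = 1)
    (hr0 : ∀ i o, 0 < r i o) (hr : ∀ i x o, w' i x o = r i o * w x o)
    (hκ : ∀ i x, ∑ o, w' i x o * Real.log (r i o) ≤ κ) (g : ι → List Ω → ℝ)
    (hB : ∀ x, ∑ i, Real.exp (g i x - 1) ≤ B) (t : ℕ) :
    ∑ i, (step halt (w' i))^[t] (g i) [] ≤
      κ * ∑ i, (step halt (w' i))^[t] (fun x => (x.length : ℝ)) [] + B := by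
  have hlog : ∀ i (x : List Ω), Real.log (x.map (r i)).prod =
      (x.map fun o => Real.log (r i o)).sum := by
    intro i x
    induction x with
    | nil => simp
    | cons o x ih =>
      have hpos : (x.map (r i)).prod ≠ 0 := by
        simp only [ne_eq, List.prod_eq_zero_iff, List.mem_map, not_exists, not_and]
        exact fun o _ => (hr0 i o).ne'
      simp only [List.map_cons, List.prod_cons, List.sum_cons]
      rw [Real.log_mul (hr0 i o).ne' hpos, ih]
  have hpos : ∀ i (x : List Ω), 0 < (x.map (r i)).prod := fun i x => by
    refine List.prod_pos ?_
    simp only [List.mem_map, forall_exists_index, and_imp, forall_apply_eq_imp_iff₂]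
    exact fun o _ => hr0 i o
  have hi : ∀ i, (step halt (w' i))^[t] (g i) [] ≤
      κ * (step halt (w' i))^[t] (fun x => (x.length : ℝ)) [] +
        (step halt w)^[t] (fun x => Real.exp (g i x - 1)) [] := by
    intro i
    have h1 := step_iterate_sum_log_le (halt := halt) (w := w' i) (r := r i)
      (fun x o => by rw [hr]; exact mul_nonneg (hr0 i o).le (hw x o)) (hw' i) (hκ i) t
    -- Changing measure for `g` minus the log-likelihood turns the model's expectation of `g`, less
    -- its relative entropy, into a reference expectation to which the pointwise inequality applies.
    have h2 := congrFun (prod_mul_step_iterate (halt := halt) (hr i) t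
      (g i - fun x : List Ω => (x.map fun o => Real.log (r i o)).sum)) []
    have h3 : (step halt w)^[t] (fun x : List Ω => (x.map (r i)).prod *
        (g i - fun x : List Ω => (x.map fun o => Real.log (r i o)).sum) x) [] ≤
        (step halt w)^[t] (fun x => Real.exp (g i x - 1)) [] := by
      refine step_iterate_mono hw t (fun x => ?_) []
      simp only [Pi.sub_apply, ← hlog]
      exact mul_sub_log_le (hpos i x)
    rw [← h2, step_iterate_sub] at h3
    simp only [List.map_nil, List.prod_nil, one_mul, Pi.sub_apply] at h3
    linarith
  have hsum : ∑ i, (step halt w)^[t] (fun x => Real.exp (g i x - 1)) [] ≤ B := by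
    have h1 := congrFun (step_iterate_sum (halt := halt) (w := w) Finset.univ t
      fun i x => Real.exp (g i x - 1)) []
    rw [Finset.sum_apply] at h1
    rw [← h1]
    have h2 := step_iterate_mono (halt := halt) hw t
      (F := ∑ i, fun x => Real.exp (g i x - 1)) (G := fun _ => B)
      (fun x => by rw [Finset.sum_apply]; exact hB x) []
    rwa [step_iterate_const hw1] at h2
  calc _ ≤ ∑ i, (κ * (step halt (w' i))^[t] (fun x => (x.length : ℝ)) [] +
        (step halt w)^[t] (fun x => Real.exp (g i x - 1)) []) := Finset.sum_le_sum fun i _ => hi i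
    _ ≤ _ := by rw [Finset.sum_add_distrib, ← Finset.mul_sum]; gcongr

end Step

/-! ### Expectations under discrete laws -/

section PMF

variable {α β : Type*}

lemma tsum_pmf_pure_mul (a : α) (g : α → ℝ≥0∞) : ∑' b, PMF.pure a b * g b = g a := by
  rw [tsum_eq_single a fun b hb => by simp [PMF.pure_apply, hb]]
  simp

lemma tsum_pmf_bind_mul (p : PMF α) (f : α → PMF β) (g : β → ℝ≥0∞) :
    ∑' b, p.bind f b * g b = ∑' a, p a * ∑' b, f a b * g b := by
  simp_rw [PMF.bind_apply, ← ENNReal.tsum_mul_right, ← ENNReal.tsum_mul_left]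
  rw [ENNReal.tsum_comm]
  simp_rw [mul_assoc]

lemma tsum_pmf_map_mul (p : PMF α) (f : α → β) (g : β → ℝ≥0∞) :
    ∑' b, p.map f b * g b = ∑' a, p a * g (f a) := by
  rw [← PMF.bind_pure_comp, tsum_pmf_bind_mul]
  simp only [Function.comp_apply, tsum_pmf_pure_mul]

lemma sum_pmf_toReal [Fintype α] (p : PMF α) : ∑ a, (p a).toReal = 1 := by
  rw [← ENNReal.toReal_sum fun a _ => p.apply_ne_top a, ← tsum_fintype (L := .unconditional _), p.tsum_coe]
  simp

lemma sum_pmf_map_toReal_mul [Fintype α] [Fintype β] (p : PMF α) (f : α → β) (g : β → ℝ) :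
    ∑ a, (p a).toReal * g (f a) = ∑ b, (p.map f b).toReal * g b := by
  classical
  have h : ∀ b, (p.map f b).toReal = ∑ a, if b = f a then (p a).toReal else 0 := by
    intro b
    rw [PMF.map_apply, tsum_fintype, ENNReal.toReal_sum]
    · refine Finset.sum_congr rfl fun a _ => ?_
      split_ifs <;> simp
    · intro a _
      split_ifs
      · exact p.apply_ne_top a
      · simp
  simp_rw [h, Finset.sum_mul]
  rw [Finset.sum_comm]
  simp

end PMF

end CMDP

namespace CMDP

/-! ### Trajectory laws -/

section Trajectories

variable {C 𝒮 𝒜 : Type} {H : ℕ}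

lemma trajLaw_succ_eq_zero (P : Fin (H + 1) → 𝒮 → 𝒜 → PMF 𝒮) (π : Policy 𝒮 𝒜 (H + 1)) (s : 𝒮)
    {τ : Trajectory 𝒮 𝒜 (H + 1)} (h : (τ 0).1 ≠ s) : trajLaw (H + 1) P π s τ = 0 := by
  by_contra h0
  have h1 := (PMF.mem_support_iff _ _).2 h0
  rw [trajLaw] at h1
  simp only [PMF.mem_support_bind_iff, PMF.mem_support_map_iff] at h1
  obtain ⟨a, -, s', -, τ', -, rfl⟩ := h1
  exact h rfl

lemma trajLaw_map_state_zero (P : Fin (H + 1) → 𝒮 → 𝒜 → PMF 𝒮) (π : Policy 𝒮 𝒜 (H + 1)) (s : 𝒮) :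
    (trajLaw (H + 1) P π s).map (fun τ => (τ 0).1) = PMF.pure s := by
  have h : ∀ (p : PMF (Trajectory 𝒮 𝒜 H)), p.map (fun _ => s) = PMF.pure s :=
    fun p => PMF.map_const p s
  simp [trajLaw, PMF.map_bind, PMF.map_comp, Function.comp_def, h]

lemma trajLaw_map_state_one (P : Fin (H + 2) → 𝒮 → 𝒜 → PMF 𝒮) (π : Policy 𝒮 𝒜 (H + 2)) (s : 𝒮) :
    (trajLaw (H + 2) P π s).map (fun τ => (τ 1).1) = (π 0 s).bind fun a => P 0 s a := by
  have h : ∀ (x : 𝒮 × 𝒜) (τ : Trajectory 𝒮 𝒜 (H + 1)),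
      (Fin.cons x τ : Trajectory 𝒮 𝒜 (H + 2)) 1 = τ 0 := fun x τ =>
    Fin.cons_succ (α := fun _ => 𝒮 × 𝒜) x τ 0
  rw [trajLaw, PMF.map_bind]
  congr 1
  funext a
  simp only [PMF.map_bind, PMF.map_comp, Function.comp_def, h, trajLaw_map_state_zero,
    PMF.bind_pure]

/-- If two families of kernels differ only in the first layer, the likelihood ratio of the two
trajectory laws is that of the second state. -/
lemma trajLaw_eq_mul {P P' : Fin (H + 2) → 𝒮 → 𝒜 → PMF 𝒮} {r : 𝒮 → ℝ≥0∞} {s : 𝒮}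
    (h0 : ∀ a s', P' 0 s a s' = r s' * P 0 s a s')
    (h1 : ∀ h : Fin (H + 1), P' h.succ = P h.succ) (π : Policy 𝒮 𝒜 (H + 2))
    (τ : Trajectory 𝒮 𝒜 (H + 2)) :
    trajLaw (H + 2) P' π s τ = r (τ 1).1 * trajLaw (H + 2) P π s τ := by
  rw [trajLaw, trajLaw]
  simp only [PMF.bind_apply, ← ENNReal.tsum_mul_left, h1]
  refine tsum_congr fun a => tsum_congr fun s' => ?_
  rw [h0]
  by_cases hs : (τ 1).1 = s'
  · rw [hs]
    ring
  -- The tail of a trajectory records its own starting state, so only the term with `s'` equal to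
  -- the second state survives, and the ratio may be evaluated there.
  · have : ((trajLaw (H + 1) (fun h => P h.succ) (fun h => π h.succ) s').map
        fun τ' => (Fin.cons (s, a) τ' : Trajectory 𝒮 𝒜 (H + 2))) τ = 0 := by
      rw [PMF.map_apply, ENNReal.tsum_eq_zero]
      intro τ'
      split_ifs with h
      · refine trajLaw_succ_eq_zero _ _ _ fun h' => hs ?_
        rw [h, ← h']
        exact congrArg Prod.fst (Fin.cons_succ (α := fun _ => 𝒮 × 𝒜) (s, a) τ' 0)
      · rfl
    simp [this]

lemma measurable_trajLaw [Countable 𝒮] [Countable 𝒜] {Ω : Type*} [MeasurableSpace Ω] (H : ℕ)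
    (P : Fin H → 𝒮 → 𝒜 → PMF 𝒮) {π : Ω → Policy 𝒮 𝒜 H}
    (hπ : ∀ h s a, Measurable fun ω => π ω h s a) (s : 𝒮) (τ : Trajectory 𝒮 𝒜 H) :
    Measurable fun ω => trajLaw H P (π ω) s τ := by
  classical
  induction H generalizing s with
  | zero => simp only [trajLaw]; exact measurable_const
  | succ H ih =>
    simp only [trajLaw, PMF.bind_apply, PMF.map_apply]
    refine Measurable.tsum fun a => (hπ 0 s a).mul (Measurable.tsum fun s' =>
      measurable_const.mul (Measurable.tsum fun τ' => ?_))
    split_ifs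
    · exact ih (fun h => P h.succ) (fun h s a => hπ h.succ s a) s' τ'
    · exact measurable_const

end Trajectories

/-! ### The interaction as a stopped experiment -/

section Run

variable {C 𝒮 𝒜 : Type} {H : ℕ} (Alg : Algorithm C 𝒮 𝒜 H) (D : PMF C) (s₁ : 𝒮)
  (M : Model C 𝒮 𝒜 H)

lemma measurable_run [Countable C] [Countable 𝒮] [Countable 𝒜] (t : ℕ) (x : History C 𝒮 𝒜 H) :
    Measurable fun ω => Alg.run D s₁ M ω t x := by
  classical
  induction t generalizing x with
  | zero => simp only [Algorithm.run]; exact measurable_const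
  | succ t ih =>
    simp only [Algorithm.run, PMF.bind_apply]
    refine Measurable.tsum fun y => (ih y).mul ?_
    have h : ∀ ω, (if Alg.halt ω y = true then PMF.pure y else D.bind fun c =>
        (trajLaw H (M c) (Alg.policy ω y c) s₁).map fun τ => y ++ [(c, τ)]) x =
        if Alg.halt ω y = true then PMF.pure y x else (D.bind fun c =>
          (trajLaw H (M c) (Alg.policy ω y c) s₁).map fun τ => y ++ [(c, τ)]) x := by
      intro ω
      split_ifs <;> rfl
    simp only [h]
    refine Measurable.ite ((Alg.measurable_halt y) (measurableSet_singleton true))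
      measurable_const ?_
    simp only [PMF.bind_apply, PMF.map_apply]
    refine Measurable.tsum fun c => measurable_const.mul (Measurable.tsum fun τ => ?_)
    split_ifs
    · exact measurable_trajLaw H (M c) (fun h s a => Alg.measurable_policy y c h s a) s₁ τ
    · exact measurable_const

lemma measurable_expectedLength [Countable C] [Countable 𝒮] [Countable 𝒜] :
    Measurable fun ω => ⨆ t : ℕ, ∑' x, Alg.run D s₁ M ω t x * (x.length : ℝ≥0∞) :=
  Measurable.iSup fun t => Measurable.tsum fun x =>
    (measurable_run Alg D s₁ M t x).mul measurable_const

/-- Stopped histories are absorbing, so their mass can only grow. -/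
lemma run_apply_mono (ω : Alg.Seed) {x : History C 𝒮 𝒜 H} (hx : Alg.halt ω x = true) :
    Monotone fun t => Alg.run D s₁ M ω t x := by
  refine monotone_nat_of_le_succ fun t => ?_
  simp only [Algorithm.run, PMF.bind_apply]
  refine le_trans ?_ (ENNReal.le_tsum x)
  simp [hx]

lemma run_toOuterMeasure_mono (ω : Alg.Seed) (good : Model C 𝒮 𝒜 H → Prop) :
    Monotone fun t => (Alg.run D s₁ M ω t).toOuterMeasure
      {x | Alg.halt ω x = true ∧ good (Alg.output ω x)} := by
  intro t t' h
  simp only [PMF.toOuterMeasure_apply]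
  refine ENNReal.tsum_le_tsum fun x => ?_
  by_cases hx : x ∈ {x | Alg.halt ω x = true ∧ good (Alg.output ω x)}
  · rw [Set.indicator_of_mem hx, Set.indicator_of_mem hx]
    exact run_apply_mono Alg D s₁ M ω hx.1 h
  · rw [Set.indicator_of_notMem hx, Set.indicator_of_notMem hx]

/-- The law of the context and the trajectory of the round after the history `x`. -/
noncomputable def roundLaw (ω : Alg.Seed) (x : History C 𝒮 𝒜 H) : PMF (C × Trajectory 𝒮 𝒜 H) :=
  D.bind fun c => (trajLaw H (M c) (Alg.policy ω x c) s₁).map fun τ => (c, τ)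

lemma roundLaw_apply (ω : Alg.Seed) (x : History C 𝒮 𝒜 H) (o : C × Trajectory 𝒮 𝒜 H) :
    roundLaw Alg D s₁ M ω x o = D o.1 * trajLaw H (M o.1) (Alg.policy ω x o.1) s₁ o.2 := by
  classical
  obtain ⟨c, τ⟩ := o
  rw [roundLaw, PMF.bind_apply, tsum_eq_single c]
  · rw [PMF.map_apply, tsum_eq_single τ]
    · simp
    · intro τ' h
      simp [Ne.symm h]
  · intro c' h
    rw [PMF.map_apply]
    simp [Ne.symm h]

lemma run_succ (ω : Alg.Seed) (t : ℕ) : Alg.run D s₁ M ω (t + 1) =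
    (Alg.run D s₁ M ω t).bind fun x => if Alg.halt ω x = true then PMF.pure x
      else (roundLaw Alg D s₁ M ω x).map fun o => x ++ [o] := by
  rw [Algorithm.run]
  congr 1
  funext x
  simp only [roundLaw, PMF.map_bind, PMF.map_comp, Function.comp_def]

/-- Bridge from the interaction to the real-valued operator `step`. The induction integrates out the
last round first, which replaces `F` by `step F`; hence `F` is general. -/
lemma tsum_run_mul [Fintype C] [Fintype 𝒮] [Fintype 𝒜] (ω : Alg.Seed) (t : ℕ)
    {F : History C 𝒮 𝒜 H → ℝ} (hF : ∀ x, 0 ≤ F x) :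
    ∑' x, Alg.run D s₁ M ω t x * ENNReal.ofReal (F x) =
      ENNReal.ofReal ((step (Alg.halt ω)
        (fun x o => (roundLaw Alg D s₁ M ω x o).toReal))^[t] F []) := by
  induction t generalizing F with
  | zero => exact tsum_pmf_pure_mul _ _
  | succ t ih =>
    rw [run_succ, tsum_pmf_bind_mul, Function.iterate_succ_apply, ← ih]
    · refine tsum_congr fun x => ?_
      congr 1
      rw [step]
      split_ifs with h
      · exact tsum_pmf_pure_mul _ _
      · rw [tsum_pmf_map_mul, tsum_fintype, ENNReal.ofReal_sum_of_nonneg fun o _ =>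
          mul_nonneg ENNReal.toReal_nonneg (hF _)]
        refine Finset.sum_congr rfl fun o _ => ?_
        rw [ENNReal.ofReal_mul ENNReal.toReal_nonneg, ENNReal.ofReal_toReal (PMF.apply_ne_top _ _)]
    · intro x
      exact step_iterate_nonneg (w := fun x o => (roundLaw Alg D s₁ M ω x o).toReal)
        (fun x o => ENNReal.toReal_nonneg) 1 hF x

lemma sum_roundLaw_mul [Fintype C] [Fintype 𝒮] [Fintype 𝒜] (ω : Alg.Seed) (x : History C 𝒮 𝒜 H)
    (F : C × Trajectory 𝒮 𝒜 H → ℝ) :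
    ∑ o, (roundLaw Alg D s₁ M ω x o).toReal * F o =
      ∑ c, (D c).toReal * ∑ τ, (trajLaw H (M c) (Alg.policy ω x c) s₁ τ).toReal * F (c, τ) := by
  rw [Fintype.sum_prod_type]
  simp only [roundLaw_apply, ENNReal.toReal_mul, Finset.mul_sum, mul_assoc]

end Run

end CMDP

namespace CMDP

/-! ### Models with a biased second state -/

section Models

variable {C 𝒮 𝒜 : Type} {H : ℕ}

/-- The law that gives mass `p` to `s₂` and mass `1 - p` to `s₁`. -/
noncomputable def coin (s₁ s₂ : 𝒮) (p : unitInterval) : PMF 𝒮 :=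
  (PMF.ofFintype (fun b : Bool => ENNReal.ofReal (if b then (p : ℝ) else 1 - p)) (by
    rw [← ENNReal.ofReal_sum_of_nonneg fun b _ => by
      split_ifs
      · exact p.2.1
      · exact sub_nonneg.2 p.2.2]
    simp)).map fun b => if b then s₂ else s₁

lemma sum_coin_mul [Fintype 𝒮] (s₁ s₂ : 𝒮) (p : unitInterval) (f : 𝒮 → ℝ) :
    ∑ s, (coin s₁ s₂ p s).toReal * f s = p * f s₂ + (1 - p) * f s₁ := by
  have h0 := p.2.1
  have h1 := sub_nonneg.2 p.2.2
  rw [coin, ← sum_pmf_map_toReal_mul]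
  simp [ENNReal.toReal_ofReal h0, ENNReal.toReal_ofReal h1]

lemma coin_apply_pos {s₁ s₂ : 𝒮} (h : s₁ ≠ s₂) (p : unitInterval) :
    coin s₁ s₂ p s₂ = ENNReal.ofReal p := by
  rw [coin, PMF.map_apply, tsum_bool]
  simp [h.symm]

lemma coin_apply_neg {s₁ s₂ : 𝒮} (h : s₁ ≠ s₂) (p : unitInterval) :
    coin s₁ s₂ p s₁ = ENNReal.ofReal (1 - p) := by
  rw [coin, PMF.map_apply, tsum_bool]
  simp [h]

lemma coin_apply_of_ne {s₁ s₂ s : 𝒮} (h : s ≠ s₁) (h' : s ≠ s₂) (p : unitInterval) :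
    coin s₁ s₂ p s = 0 := by
  rw [coin, PMF.map_apply, tsum_bool]
  simp [h, h']

/-- The model in which the second state is `s₂` with probability `p c` and `s₁` otherwise, whatever
the actions are. -/
noncomputable def biasedModel (s₁ s₂ : 𝒮) (p : C → unitInterval) : Model C 𝒮 𝒜 H :=
  fun c h _ _ => if h.val = 0 then coin s₁ s₂ (p c) else PMF.pure s₁

lemma biasedModel_injective [Nonempty 𝒜] {s₁ s₂ : 𝒮} (h : s₁ ≠ s₂) :
    Function.Injective (biasedModel s₁ s₂ : (C → unitInterval) → Model C 𝒮 𝒜 (H + 1)) := by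
  intro p q hpq
  funext c
  obtain ⟨a⟩ := ‹Nonempty 𝒜›
  have h1 := DFunLike.congr_fun (congrFun (congrFun (congrFun (congrFun hpq c) 0) s₁) a) s₂
  simp only [biasedModel, Fin.val_zero, if_true, coin_apply_pos h] at h1
  exact Subtype.ext ((ENNReal.ofReal_eq_ofReal_iff (p c).2.1 (q c).2.1).1 h1)

/-- The kernels ignore the actions, so the policy drops out. Both the values and the one-round
relative entropy are computed from this. -/
lemma sum_trajLaw_biasedModel [Fintype 𝒮] [Fintype 𝒜] (s₁ s₂ : 𝒮) (p : C → unitInterval) (c : C)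
    (π : Policy 𝒮 𝒜 (H + 2)) (f : 𝒮 → ℝ) :
    ∑ τ, (trajLaw (H + 2) (biasedModel s₁ s₂ p c) π s₁ τ).toReal * f (τ 1).1 =
      p c * f s₂ + (1 - p c) * f s₁ := by
  rw [sum_pmf_map_toReal_mul _ (fun τ : Trajectory 𝒮 𝒜 (H + 2) => (τ 1).1) f,
    trajLaw_map_state_one, ← sum_coin_mul s₁ s₂ (p c) f]
  simp [biasedModel]

open Classical in
/-- The reward `1` for reaching `s₂` in the second layer. -/
noncomputable def secondStateReward (s₂ : 𝒮) : Reward C 𝒮 𝒜 H :=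
  fun _ h s _ => ⟨Measure.dirac (if h.val = 1 ∧ s = s₂ then 1 else 0), inferInstance⟩

open Classical in
lemma secondStateReward_mean (s₂ : 𝒮) (c : C) (h : Fin H) (s : 𝒮) (a : 𝒜) :
    (secondStateReward s₂ : Reward C 𝒮 𝒜 H).mean c h s a =
      if h.val = 1 ∧ s = s₂ then 1 else 0 := by
  simp only [Reward.mean, secondStateReward, ProbabilityMeasure.coe_mk, integral_dirac]
  split_ifs <;> simp

open Classical in
lemma sum_ite_val_eq_one (s₂ : 𝒮) (τ : Trajectory 𝒮 𝒜 (H + 2)) :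
    ∑ h : Fin (H + 2), (if h.val = 1 ∧ (τ h).1 = s₂ then 1 else 0 : ℝ) =
      if (τ 1).1 = s₂ then 1 else 0 := by
  rw [Finset.sum_eq_single 1]
  · simp
  · intro h _ hh
    have : h.val ≠ 1 := fun h' => hh (Fin.ext (by simpa using h'))
    simp [this]
  · simp

lemma secondStateReward_normalized (s₂ : 𝒮) :
    (secondStateReward s₂ : Reward C 𝒮 𝒜 (H + 2)).Normalized := by
  classical
  intro c τ
  simp only [secondStateReward, ProbabilityMeasure.coe_mk]
  have h : ∀ᵐ r : Fin (H + 2) → unitInterval ∂(Measure.pi fun h : Fin (H + 2) =>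
      Measure.dirac (if h.val = 1 ∧ (τ h).1 = s₂ then (1 : unitInterval) else 0)),
      ∀ h, r h = if h.val = 1 ∧ (τ h).1 = s₂ then 1 else 0 := by
    rw [ae_all_iff]
    intro i
    refine (Measure.tendsto_eval_ae_ae (i := i)).eventually
      (p := fun r : unitInterval => r = if i.val = 1 ∧ (τ i).1 = s₂ then 1 else 0) ?_
    rw [ae_dirac_eq, Filter.eventually_pure]
  filter_upwards [h] with r hr
  have : ∀ i, (r i : ℝ) = if i.val = 1 ∧ (τ i).1 = s₂ then 1 else 0 := by
    intro i
    rw [hr]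
    split_ifs <;> rfl
  simp only [this, sum_ite_val_eq_one]
  split_ifs <;> norm_num

lemma value_biasedModel [Fintype 𝒮] [Fintype 𝒜] {s₁ s₂ : 𝒮} (h : s₁ ≠ s₂) (p : C → unitInterval) (c : C)
    (π : Policy 𝒮 𝒜 (H + 2)) :
    value s₁ (biasedModel s₁ s₂ p) π c (secondStateReward s₂) = p c := by
  classical
  simp only [value, secondStateReward_mean, sum_ite_val_eq_one]
  rw [sum_trajLaw_biasedModel s₁ s₂ p c π fun s => if s = s₂ then 1 else 0]
  simp [h]

lemma maxValue_biasedModel [Fintype 𝒮] [Fintype 𝒜] [Nonempty 𝒜] {s₁ s₂ : 𝒮} (h : s₁ ≠ s₂) (p : C → unitInterval) (c : C)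
    (π : Policy 𝒮 𝒜 (H + 2)) :
    maxValue s₁ (biasedModel s₁ s₂ p) π c (secondStateReward s₂) = p c := by
  simp only [maxValue, value_biasedModel h, ciSup_const]

/-- An accurate prediction for a biased model estimates the biases. -/
lemma sum_abs_sub_le_of_accurate [Fintype C] [Nonempty C] {s₁ s₂ : 𝒮} {ε : ℝ}
    {V : Model C 𝒮 𝒜 (H + 2) → Policy 𝒮 𝒜 (H + 2) → C → Reward C 𝒮 𝒜 (H + 2) → ℝ}
    (hV : ∀ p π c, V (biasedModel s₁ s₂ p) π c (secondStateReward s₂) = p c)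
    (π : Policy 𝒮 𝒜 (H + 2)) {p : C → unitInterval} {M : Model C 𝒮 𝒜 (H + 2)}
    (hM : Accurate (PMF.uniformOfFintype C) V ε (biasedModel s₁ s₂ p) M) :
    ∑ c, |(p c : ℝ) - V M π c (secondStateReward s₂)| ≤ Fintype.card C * ε := by
  have h := hM _ (secondStateReward_normalized s₂) fun _ => π
  simp only [hV, PMF.uniformOfFintype_apply, ENNReal.toReal_inv, ENNReal.toReal_natCast,
    ← Finset.mul_sum] at h
  rwa [inv_mul_le_iff₀ (by exact_mod_cast Fintype.card_pos)] at h

end Models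

/-! ### Counting sign vectors near an estimate -/

section Counting

/-- The biases `1/2 ± ε/4`. -/
noncomputable def signBias (ε : ℝ) (b : Bool) : ℝ := if b then 1 / 2 + ε / 4 else 1 / 2 - ε / 4

/-- The two biases are `ε/2` apart, so `y` cannot be close to both: the two exponentials `a, b ≤ 1`
satisfy `a * b ≤ exp (-2)`, and `(1 - a) * (1 - b) ≥ 0` gives `a + b ≤ 1 + a * b`. -/
lemma sum_exp_signBias_le {ε : ℝ} (hε : 0 < ε) (y : ℝ) :
    ∑ b, Real.exp (-4 * |signBias ε b - y| / ε) ≤ 1 + Real.exp (-2) := by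
  simp only [Fintype.sum_bool, signBias, if_true, Bool.false_eq_true, if_false]
  set u := |1 / 2 + ε / 4 - y|
  set v := |1 / 2 - ε / 4 - y|
  have huv : ε / 2 ≤ u + v := by
    have h1 := le_abs_self (1 / 2 + ε / 4 - y)
    have h2 := neg_abs_le (1 / 2 - ε / 4 - y)
    linarith
  have ha : Real.exp (-4 * u / ε) ≤ 1 := Real.exp_le_one_iff.2
    (div_nonpos_of_nonpos_of_nonneg (by linarith [abs_nonneg (1 / 2 + ε / 4 - y)]) hε.le)
  have hb : Real.exp (-4 * v / ε) ≤ 1 := Real.exp_le_one_iff.2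
    (div_nonpos_of_nonpos_of_nonneg (by linarith [abs_nonneg (1 / 2 - ε / 4 - y)]) hε.le)
  have hab : Real.exp (-4 * u / ε) * Real.exp (-4 * v / ε) ≤ Real.exp (-2) := by
    rw [← Real.exp_add, Real.exp_le_exp, ← add_div, div_le_iff₀ hε]
    linarith
  nlinarith

lemma exp_half_mul_le : Real.exp (1 / 2) * (1 + Real.exp (-2)) ≤ 2 := by
  have h1 := Real.exp_one_lt_d9
  have h2 := Real.exp_one_gt_d9
  have h3 : Real.exp (1 / 2) ≤ 1.65 := by
    refine (sq_le_sq₀ (Real.exp_nonneg _) (by norm_num)).1 ?_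
    rw [← Real.exp_nat_mul]
    norm_num at h1 ⊢
    linarith
  have h4 : Real.exp (-2) ≤ 1 / 7 := by
    have h5 : Real.exp (-2) * (Real.exp 1 * Real.exp 1) = 1 := by
      rw [← Real.exp_add, ← Real.exp_add]
      norm_num
    have h6 : 7 ≤ Real.exp 1 * Real.exp 1 := by nlinarith
    nlinarith [Real.exp_pos (-2)]
  nlinarith [Real.exp_pos (-2), Real.exp_pos (1 / 2)]

/-- Few sign vectors are close to a given vector. -/
lemma sum_exp_close_le {C : Type*} [Fintype C] [DecidableEq C] {ε : ℝ} (hε : 0 < ε) (y : C → ℝ)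
    {P : (C → Bool) → Prop} [DecidablePred P]
    (hP : ∀ σ, P σ → ∑ c, |signBias ε (σ c) - y c| ≤ Fintype.card C * (ε / 24)) :
    ∑ σ : C → Bool, Real.exp (Fintype.card C / 3 * (if P σ then 1 else 0) - 1) ≤
      2 ^ Fintype.card C := by
  set n := Fintype.card C
  -- Exponential Markov inequality: the indicator is dominated by a product over contexts.
  have h1 : ∀ σ : C → Bool, Real.exp (n / 3 * (if P σ then 1 else 0)) ≤
      1 + Real.exp (n / 2) * ∏ c, Real.exp (-4 * |signBias ε (σ c) - y c| / ε) := by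
    intro σ
    rw [← Real.exp_sum, ← Real.exp_add]
    split_ifs with h
    · have h2 : ∑ c, -4 * |signBias ε (σ c) - y c| / ε =
          -4 / ε * ∑ c, |signBias ε (σ c) - y c| := by
        rw [Finset.mul_sum]
        exact Finset.sum_congr rfl fun c _ => by ring
      -- The radius `n * ε / 24` costs `n/6` in the exponent, leaving `n/2 - n/6 = n/3`.
      have h3 : (n : ℝ) / 3 * 1 ≤ n / 2 + -4 / ε * ∑ c, |signBias ε (σ c) - y c| := by
        have h4 : 4 / ε * ∑ c, |signBias ε (σ c) - y c| ≤ 4 / ε * (n * (ε / 24)) :=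
          mul_le_mul_of_nonneg_left (hP σ h) (by positivity)
        have h5 : 4 / ε * (n * (ε / 24)) = n / 6 := by
          field_simp
          ring
        rw [neg_div, neg_mul]
        linarith
      rw [h2]
      linarith [Real.exp_le_exp.2 h3]
    · simp [Real.exp_nonneg]
  have h2 : ∑ σ : C → Bool, ∏ c, Real.exp (-4 * |signBias ε (σ c) - y c| / ε) ≤
      (1 + Real.exp (-2)) ^ n := by
    -- Summing over all sign vectors factorizes into a product of sums over one sign.
    rw [← Fintype.prod_sum fun c b => Real.exp (-4 * |signBias ε b - y c| / ε)]
    refine (Finset.prod_le_prod (fun c _ => Finset.sum_nonneg fun b _ => Real.exp_nonneg _)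
      fun c _ => sum_exp_signBias_le hε (y c)).trans ?_
    simp [n]
  have h3 : Real.exp (n / 2) * (1 + Real.exp (-2)) ^ n ≤ 2 ^ n := by
    have h4 : Real.exp (n / 2) = Real.exp (1 / 2) ^ n := by
      rw [← Real.exp_nat_mul]
      ring_nf
    rw [h4, ← mul_pow]
    exact pow_le_pow_left₀ (by positivity) exp_half_mul_le n
  have h4 : ∑ σ : C → Bool, Real.exp (n / 3 * (if P σ then 1 else 0)) ≤ 2 * 2 ^ n := by
    refine (Finset.sum_le_sum fun σ _ => h1 σ).trans ?_
    rw [Finset.sum_add_distrib, ← Finset.mul_sum]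
    have h5 : ∑ _σ : C → Bool, (1 : ℝ) = 2 ^ n := by simp [n]
    have h6 := mul_le_mul_of_nonneg_left h2 (Real.exp_nonneg (n / 2))
    linarith
  simp only [Real.exp_sub, ← Finset.sum_div]
  rw [div_le_iff₀ (Real.exp_pos 1)]
  -- The `-1` in the exponent absorbs the factor `2`.
  have h5 : (2 : ℝ) ≤ Real.exp 1 := by linarith [Real.exp_one_gt_d9]
  nlinarith [show (0 : ℝ) < 2 ^ n by positivity]

end Counting

end CMDP

/-! ### The lower bound for sign models -/

namespace CMDP

/-- Superadditivity needs no measurability. It is applied to success probabilities, where the set of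
good outputs is an arbitrary predicate. -/
lemma sum_lintegral_le {α ι : Type*} [MeasurableSpace α] (μ : Measure α) (s : Finset ι)
    (f : ι → α → ℝ≥0∞) : ∑ i ∈ s, ∫⁻ a, f i a ∂μ ≤ ∫⁻ a, ∑ i ∈ s, f i a ∂μ := by
  classical
  induction s using Finset.induction_on with
  | empty => simp
  | insert i s hi ih =>
    simp only [Finset.sum_insert hi]
    exact (add_le_add_right ih _).trans (le_lintegral_add _ _)

section LowerBound

variable {C 𝒮 𝒜 : Type} {H : ℕ}

/-- The bias `1/2`. -/
noncomputable def fairBias : unitInterval := ⟨1 / 2, by norm_num, by norm_num⟩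

lemma signBias_pos {ε : ℝ} (hε : 0 < ε) (hε1 : ε ≤ 1) (b : Bool) : 0 < signBias ε b := by
  unfold signBias
  split_ifs <;> linarith

lemma signBias_lt_one {ε : ℝ} (hε : 0 < ε) (hε1 : ε ≤ 1) (b : Bool) : signBias ε b < 1 := by
  unfold signBias
  split_ifs <;> linarith

/-- The models whose biases are `1/2 ± ε/4`, with arbitrary signs. -/
noncomputable def signModel (s₁ s₂ : 𝒮) {ε : ℝ} (hε : 0 < ε) (hε1 : ε ≤ 1) (σ : C → Bool) :
    Model C 𝒮 𝒜 H :=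
  biasedModel s₁ s₂ fun c =>
    ⟨signBias ε (σ c), (signBias_pos hε hε1 _).le, (signBias_lt_one hε hε1 _).le⟩

lemma signModel_injective [Nonempty 𝒜] {s₁ s₂ : 𝒮} (h : s₁ ≠ s₂) {ε : ℝ} (hε : 0 < ε)
    (hε1 : ε ≤ 1) :
    Function.Injective (signModel s₁ s₂ hε hε1 : (C → Bool) → Model C 𝒮 𝒜 (H + 1)) := by
  intro σ σ' hσ
  funext c
  have h1 : signBias ε (σ c) = signBias ε (σ' c) :=
    congrArg Subtype.val (congrFun (biasedModel_injective h hσ) c)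
  revert h1
  cases σ c <;> cases σ' c <;> simp [signBias] <;> intro h <;> linarith

open Classical in
/-- The likelihood ratio of the second state under the bias `signBias ε b` and the bias `1/2`. -/
noncomputable def signRatio (s₂ : 𝒮) (ε : ℝ) (b : Bool) (s : 𝒮) : ℝ :=
  2 * if s = s₂ then signBias ε b else 1 - signBias ε b

lemma signRatio_pos (s₂ : 𝒮) {ε : ℝ} (hε : 0 < ε) (hε1 : ε ≤ 1) (b : Bool) (s : 𝒮) :
    0 < signRatio s₂ ε b s := by
  have h0 := signBias_pos hε hε1 b
  have h1 := signBias_lt_one hε hε1 b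
  unfold signRatio
  split_ifs <;> linarith

lemma coin_signBias_eq {s₁ s₂ : 𝒮} (h : s₁ ≠ s₂) {ε : ℝ} (hε : 0 < ε) (hε1 : ε ≤ 1) (b : Bool)
    (s : 𝒮) :
    coin s₁ s₂ ⟨signBias ε b, (signBias_pos hε hε1 _).le, (signBias_lt_one hε hε1 _).le⟩ s =
      ENNReal.ofReal (signRatio s₂ ε b s) * coin s₁ s₂ fairBias s := by
  by_cases h2 : s = s₂
  · subst h2
    rw [coin_apply_pos h, coin_apply_pos h, ← ENNReal.ofReal_mul (signRatio_pos s hε hε1 b s).le]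
    congr 1
    simp [signRatio, fairBias]
    ring
  · by_cases h1 : s = s₁
    · subst h1
      rw [coin_apply_neg h, coin_apply_neg h,
        ← ENNReal.ofReal_mul (signRatio_pos s₂ hε hε1 b s).le]
      congr 1
      simp [signRatio, fairBias, h2]
      ring
    -- Elsewhere both coins have mass zero, so the ratio may take any value there.
    · simp [coin_apply_of_ne h1 h2]

/-- The context law and the algorithm's choice of policy are common to both models and cancel; only
the second state contributes. -/
lemma roundLaw_signModel {s₁ s₂ : 𝒮} (h : s₁ ≠ s₂) {ε : ℝ} (hε : 0 < ε) (hε1 : ε ≤ 1)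
    (Alg : Algorithm C 𝒮 𝒜 (H + 2)) (D : PMF C) (σ : C → Bool) (ω : Alg.Seed)
    (x : History C 𝒮 𝒜 (H + 2)) (o : C × Trajectory 𝒮 𝒜 (H + 2)) :
    (roundLaw Alg D s₁ (signModel s₁ s₂ hε hε1 σ) ω x o).toReal =
      signRatio s₂ ε (σ o.1) (o.2 1).1 *
        (roundLaw Alg D s₁ (biasedModel s₁ s₂ fun _ => fairBias) ω x o).toReal := by
  rw [roundLaw_apply, roundLaw_apply, trajLaw_eq_mul
    (P := biasedModel s₁ s₂ (fun _ => fairBias) o.1) (P' := signModel s₁ s₂ hε hε1 σ o.1)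
    (r := fun s => ENNReal.ofReal (signRatio s₂ ε (σ o.1) s))]
  · simp only [ENNReal.toReal_mul, ENNReal.toReal_ofReal (signRatio_pos s₂ hε hε1 _ _).le]
    ring
  · intro a s'
    simp only [signModel, biasedModel, Fin.val_zero, if_true]
    exact coin_signBias_eq h hε hε1 _ _
  · intro i
    funext s a
    simp [signModel, biasedModel]

/-- By `log x ≤ x - 1` the relative entropy is at most the chi-square divergence, which for a coin
of bias `1/2 ± ε/4` against a fair coin is exactly `ε ^ 2 / 4`. -/
lemma sum_roundLaw_signModel_mul_log_le [Fintype C] [Fintype 𝒮] [Fintype 𝒜] {s₁ s₂ : 𝒮}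
    (h : s₁ ≠ s₂) {ε : ℝ} (hε : 0 < ε) (hε1 : ε ≤ 1)
    (Alg : Algorithm C 𝒮 𝒜 (H + 2)) (D : PMF C) (σ : C → Bool) (ω : Alg.Seed)
    (x : History C 𝒮 𝒜 (H + 2)) :
    ∑ o, (roundLaw Alg D s₁ (signModel s₁ s₂ hε hε1 σ) ω x o).toReal *
      Real.log (signRatio s₂ ε (σ o.1) (o.2 1).1) ≤ ε ^ 2 / 4 := by
  have key : ∀ b, signBias ε b * Real.log (signRatio s₂ ε b s₂) +
      (1 - signBias ε b) * Real.log (signRatio s₂ ε b s₁) ≤ ε ^ 2 / 4 := by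
    intro b
    have h0 := signBias_pos hε hε1 b
    have h1 := signBias_lt_one hε hε1 b
    have h2 := mul_le_mul_of_nonneg_left
      (Real.log_le_sub_one_of_pos (signRatio_pos s₂ hε hε1 b s₂)) h0.le
    have h3 := mul_le_mul_of_nonneg_left
      (Real.log_le_sub_one_of_pos (signRatio_pos s₂ hε hε1 b s₁)) (sub_nonneg.2 h1.le)
    have h4 : signBias ε b * (signRatio s₂ ε b s₂ - 1) +
        (1 - signBias ε b) * (signRatio s₂ ε b s₁ - 1) = ε ^ 2 / 4 := by
      simp only [signRatio, if_true, h, if_false]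
      cases b <;> simp [signBias] <;> ring
    linarith
  rw [sum_roundLaw_mul Alg D s₁ (signModel s₁ s₂ hε hε1 σ) ω x fun o =>
    Real.log (signRatio s₂ ε (σ o.1) (o.2 1).1)]
  calc _ ≤ ∑ c, (D c).toReal * (ε ^ 2 / 4) := by
        refine Finset.sum_le_sum fun c _ => mul_le_mul_of_nonneg_left ?_ ENNReal.toReal_nonneg
        rw [signModel, sum_trajLaw_biasedModel s₁ s₂ _ c _ fun s =>
          Real.log (signRatio s₂ ε (σ c) s)]
        exact key (σ c)
    _ = ε ^ 2 / 4 := by rw [← Finset.sum_mul, sum_pmf_toReal, one_mul]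

/-- The lower bound for a fixed seed and finitely many rounds. -/
lemma sum_run_toOuterMeasure_le [Fintype C] [DecidableEq C] [Fintype 𝒮] [Fintype 𝒜] {s₁ s₂ : 𝒮}
    (h : s₁ ≠ s₂) {ε : ℝ} (hε : 0 < ε) (hε1 : ε ≤ 1)
    (Alg : Algorithm C 𝒮 𝒜 (H + 2)) (D : PMF C)
    {good : (C → Bool) → Model C 𝒮 𝒜 (H + 2) → Prop} (y : Model C 𝒮 𝒜 (H + 2) → C → ℝ)
    (hgood : ∀ σ M, good σ M →
      ∑ c, |signBias ε (σ c) - y M c| ≤ Fintype.card C * (ε / 24)) (ω : Alg.Seed) (t : ℕ) :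
    ∑ σ, ENNReal.ofReal (Fintype.card C / 3) *
        (Alg.run D s₁ (signModel s₁ s₂ hε hε1 σ) ω t).toOuterMeasure
          {x | Alg.halt ω x = true ∧ good σ (Alg.output ω x)} ≤
      ENNReal.ofReal (ε ^ 2 / 4) *
        ∑ σ, ∑' x, Alg.run D s₁ (signModel s₁ s₂ hε hε1 σ) ω t x * (x.length : ℝ≥0∞) +
        2 ^ Fintype.card C := by
  classical
  set n := Fintype.card C
  let g : (C → Bool) → History C 𝒮 𝒜 (H + 2) → ℝ := fun σ x =>
    n / 3 * if Alg.halt ω x = true ∧ good σ (Alg.output ω x) then 1 else 0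
  have hg : ∀ σ x, 0 ≤ g σ x := fun σ x =>
    mul_nonneg (by positivity) (by split_ifs <;> norm_num)
  have h1 : ∀ σ, ENNReal.ofReal (n / 3) *
      (Alg.run D s₁ (signModel s₁ s₂ hε hε1 σ) ω t).toOuterMeasure
        {x | Alg.halt ω x = true ∧ good σ (Alg.output ω x)} =
      ∑' x, Alg.run D s₁ (signModel s₁ s₂ hε hε1 σ) ω t x * ENNReal.ofReal (g σ x) := by
    intro σ
    rw [PMF.toOuterMeasure_apply, ← ENNReal.tsum_mul_left]
    refine tsum_congr fun x => ?_
    by_cases hx : Alg.halt ω x = true ∧ good σ (Alg.output ω x)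
    · rw [Set.indicator_of_mem (by exact hx)]
      simp [g, hx, mul_comm]
    · rw [Set.indicator_of_notMem (by exact hx)]
      simp [g, hx]
  have h2 : ∀ σ, ∑' x, Alg.run D s₁ (signModel s₁ s₂ hε hε1 σ) ω t x * (x.length : ℝ≥0∞) =
      ∑' x, Alg.run D s₁ (signModel s₁ s₂ hε hε1 σ) ω t x * ENNReal.ofReal (x.length : ℝ) := by
    intro σ
    simp only [ENNReal.ofReal_natCast]
  have hlen : ∀ x : History C 𝒮 𝒜 (H + 2), 0 ≤ (x.length : ℝ) := fun x => Nat.cast_nonneg _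
  have hB : ∀ x, ∑ σ, Real.exp (g σ x - 1) ≤ 2 ^ n := fun x =>
    sum_exp_close_le hε (y (Alg.output ω x))
      (P := fun σ => Alg.halt ω x = true ∧ good σ (Alg.output ω x)) fun σ hσ => hgood σ _ hσ.2
  clear_value g
  have hreal := sum_step_iterate_le (halt := Alg.halt ω)
    (w := fun x o => (roundLaw Alg D s₁ (biasedModel s₁ s₂ fun _ => fairBias) ω x o).toReal)
    (w' := fun σ x o => (roundLaw Alg D s₁ (signModel s₁ s₂ hε hε1 σ) ω x o).toReal)
    (r := fun σ o => signRatio s₂ ε (σ o.1) (o.2 1).1)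
    (fun x o => ENNReal.toReal_nonneg) (fun x => sum_pmf_toReal _) (fun σ x => sum_pmf_toReal _)
    (fun σ o => signRatio_pos s₂ hε hε1 _ _)
    (fun σ x o => roundLaw_signModel h hε hε1 Alg D σ ω x o)
    (fun σ x => sum_roundLaw_signModel_mul_log_le h hε hε1 Alg D σ ω x) g hB t
  have hnn : ∀ σ, 0 ≤ (step (Alg.halt ω) fun x o =>
      (roundLaw Alg D s₁ (signModel s₁ s₂ hε hε1 σ) ω x o).toReal)^[t]
        (fun x => (x.length : ℝ)) [] := fun σ =>
    step_iterate_nonneg (fun x o => ENNReal.toReal_nonneg) t hlen []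
  have hgn : ∀ σ, 0 ≤ (step (Alg.halt ω) fun x o =>
      (roundLaw Alg D s₁ (signModel s₁ s₂ hε hε1 σ) ω x o).toReal)^[t] (g σ) [] := fun σ =>
    step_iterate_nonneg (fun x o => ENNReal.toReal_nonneg) t (hg σ) []
  have h2n : (2 : ℝ≥0∞) ^ n = ENNReal.ofReal (2 ^ n) := by
    rw [ENNReal.ofReal_pow (by norm_num)]
    norm_num
  rw [Finset.sum_congr rfl fun σ _ => (h1 σ).trans (tsum_run_mul _ _ _ _ _ _ (hg σ)),
    Finset.sum_congr rfl fun σ _ => (h2 σ).trans (tsum_run_mul _ _ _ _ _ _ hlen),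
    ← ENNReal.ofReal_sum_of_nonneg fun σ _ => hgn σ,
    ← ENNReal.ofReal_sum_of_nonneg fun σ _ => hnn σ, ← ENNReal.ofReal_mul (by positivity), h2n,
    ← ENNReal.ofReal_add (mul_nonneg (by positivity) (Finset.sum_nonneg fun σ _ => hnn σ))
      (by positivity)]
  exact ENNReal.ofReal_le_ofReal hreal

/-- The lower bound for an algorithm that succeeds with probability at least `1/2` on every sign
model. -/
lemma le_sum_expectedTrajectories [Fintype C] [DecidableEq C] [Fintype 𝒮] [Fintype 𝒜] {s₁ s₂ : 𝒮}
    (h : s₁ ≠ s₂) {ε : ℝ} (hε : 0 < ε) (hε1 : ε ≤ 1)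
    (Alg : Algorithm C 𝒮 𝒜 (H + 2)) (D : PMF C)
    {good : (C → Bool) → Model C 𝒮 𝒜 (H + 2) → Prop} (y : Model C 𝒮 𝒜 (H + 2) → C → ℝ)
    (hgood : ∀ σ M, good σ M →
      ∑ c, |signBias ε (σ c) - y M c| ≤ Fintype.card C * (ε / 24))
    (hlearn : ∀ σ, ENNReal.ofReal (1 / 2) ≤
      Alg.outputProb D s₁ (signModel s₁ s₂ hε hε1 σ) (good σ)) :
    2 ^ Fintype.card C * ENNReal.ofReal (Fintype.card C / 6) ≤
      ENNReal.ofReal (ε ^ 2 / 4) *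
        ∑ σ, Alg.expectedTrajectories D s₁ (signModel s₁ s₂ hε hε1 σ) + 2 ^ Fintype.card C := by
  set n := Fintype.card C with hn
  let p : (C → Bool) → Alg.Seed → ℕ → ℝ≥0∞ := fun σ ω t =>
    (Alg.run D s₁ (signModel s₁ s₂ hε hε1 σ) ω t).toOuterMeasure
      {x | Alg.halt ω x = true ∧ good σ (Alg.output ω x)}
  let T : (C → Bool) → Alg.Seed → ℕ → ℝ≥0∞ := fun σ ω t =>
    ∑' x, Alg.run D s₁ (signModel s₁ s₂ hε hε1 σ) ω t x * (x.length : ℝ≥0∞)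
  have hω : ∀ ω, ∑ σ, ENNReal.ofReal (n / 3) * ⨆ t, p σ ω t ≤
      ENNReal.ofReal (ε ^ 2 / 4) * (∑ σ, ⨆ t, T σ ω t) + 2 ^ n := by
    intro ω
    -- Monotonicity in `t` lets the supremum leave the finite sum, so the bound for each finite `t`
    -- suffices.
    have hmono : ∀ σ, Monotone fun t => ENNReal.ofReal (n / 3) * p σ ω t := fun σ t t' htt' =>
      mul_le_mul_right (run_toOuterMeasure_mono Alg D s₁ _ ω (good σ) htt') _
    simp only [ENNReal.mul_iSup]
    rw [ENNReal.finsetSum_iSup_of_monotone hmono]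
    refine iSup_le fun t => (sum_run_toOuterMeasure_le h hε hε1 Alg D y hgood ω t).trans ?_
    gcongr with σ
    exact le_iSup (T σ ω) t
  have hT : ∀ σ, Measurable fun ω => ⨆ t, T σ ω t := fun σ =>
    measurable_expectedLength Alg D s₁ _
  calc (2 : ℝ≥0∞) ^ n * ENNReal.ofReal (n / 6)
      = ∑ _σ : C → Bool, ENNReal.ofReal (n / 3) * ENNReal.ofReal (1 / 2) := by
        rw [← ENNReal.ofReal_mul (by positivity)]
        simp only [Finset.sum_const, Finset.card_univ, Fintype.card_fun, Fintype.card_bool,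
          nsmul_eq_mul, ← hn]
        push_cast
        congr 2
        ring
    _ ≤ ∑ σ, ENNReal.ofReal (n / 3) * ∫⁻ ω, ⨆ t, p σ ω t ∂Alg.seedLaw :=
        Finset.sum_le_sum fun σ _ => mul_le_mul_right (hlearn σ) _
    _ = ∑ σ, ∫⁻ ω, ENNReal.ofReal (n / 3) * ⨆ t, p σ ω t ∂Alg.seedLaw :=
        Finset.sum_congr rfl fun σ _ => (lintegral_const_mul' _ _ ENNReal.ofReal_ne_top).symm
    _ ≤ ∫⁻ ω, ∑ σ, ENNReal.ofReal (n / 3) * ⨆ t, p σ ω t ∂Alg.seedLaw := sum_lintegral_le _ _ _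
    _ ≤ ∫⁻ ω, (ENNReal.ofReal (ε ^ 2 / 4) * (∑ σ, ⨆ t, T σ ω t) + 2 ^ n) ∂Alg.seedLaw :=
        lintegral_mono hω
    _ = _ := by
        rw [lintegral_add_right _ measurable_const,
          lintegral_const_mul' _ _ ENNReal.ofReal_ne_top,
          lintegral_finsetSum _ fun σ _ => hT σ]
        simp [T, Algorithm.expectedTrajectories]

end LowerBound

/-- For `n ≥ 12` the additive term is absorbed by `n/6 - 1 ≥ n/12`, so the average is at least `n /
(3 * ε ^ 2)`; moreover `log K ≤ (n + 1) * log 2 ≤ n`. -/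
lemma mul_log_div_sq_le {ε : ℝ} (hε : 0 < ε) {K n : ℕ} (hn : n = Nat.log 2 K) (hn12 : 12 ≤ n)
    {T : ℝ≥0∞} (hT : (2 : ℝ≥0∞) ^ n * ENNReal.ofReal (n / 6) ≤
      ENNReal.ofReal (ε ^ 2 / 4) * T + 2 ^ n) :
    ENNReal.ofReal (1 / 3 * Real.log K / ε ^ 2) ≤ (2 ^ n)⁻¹ * T := by
  by_cases hT' : T = ⊤
  · rw [hT', ENNReal.mul_top (by simp)]
    exact le_top
  lift T to NNReal using hT'
  have h2 : (2 : ℝ≥0∞) ^ n = ENNReal.ofReal (2 ^ n) := by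
    rw [ENNReal.ofReal_pow (by norm_num)]
    norm_num
  have hpow : (0 : ℝ) < 2 ^ n := by positivity
  rw [h2, ← ENNReal.ofReal_coe_nnreal, ← ENNReal.ofReal_mul hpow.le,
    ← ENNReal.ofReal_mul (by positivity), ← ENNReal.ofReal_add (by positivity) hpow.le,
    ENNReal.ofReal_le_ofReal_iff (by positivity)] at hT
  rw [h2, ← ENNReal.ofReal_inv_of_pos hpow, ← ENNReal.ofReal_coe_nnreal,
    ← ENNReal.ofReal_mul (by positivity)]
  refine ENNReal.ofReal_le_ofReal ?_
  have hK : Real.log K ≤ n := by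
    have hK1 : (K : ℝ) ≤ 2 ^ (n + 1) := by
      rw [hn]
      exact_mod_cast (Nat.lt_pow_succ_log_self (by norm_num) K).le
    have hK0 : (0 : ℝ) < K := by
      rcases Nat.eq_zero_or_pos K with rfl | h
      · simp at hn
        omega
      · exact_mod_cast h
    have h3 := Real.log_le_log hK0 hK1
    rw [Real.log_pow] at h3
    have h4 := Real.log_two_lt_d9
    have h5 : (12 : ℝ) ≤ n := by exact_mod_cast hn12
    push_cast at h3
    nlinarith
  have h5 : (12 : ℝ) ≤ n := by exact_mod_cast hn12
  set X : ℝ := (2 ^ n)⁻¹ * T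
  have hX : (T : ℝ) = 2 ^ n * X := by
    simp only [X]
    field_simp
  rw [hX] at hT
  have hT2 : (2 : ℝ) ^ n * (n / 6) ≤ 2 ^ n * (ε ^ 2 / 4 * X + 1) := by linarith
  have hT3 := le_of_mul_le_mul_left hT2 hpow
  rw [div_le_iff₀ (by positivity)]
  nlinarith

end CMDP

/-! ### Assembly of the theorem -/

theorem theorem6p2 :
    ∃ (L κ : ℝ) (K₀ : ℕ), 0 < L ∧ 0 < κ ∧
      ∀ (ε δ : ℝ) (H A S K : ℕ), 0 < ε → ε ≤ 1 → δ ≤ 1 / 2 → 2 ≤ H → 2 ≤ A →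
        L * Real.log A ≤ S → K₀ ≤ K →
        ∃ (n : ℕ) (D : PMF (Fin n)) (s₁ : Fin S)
          (𝓜 : Finset (CMDP.Model (Fin n) (Fin S) (Fin A) H)) (μ : PMF 𝓜),
          𝓜.card = K ∧
          ∀ Alg : CMDP.Algorithm (Fin n) (Fin S) (Fin A) H,
            (Alg.Learns D s₁ (CMDP.value s₁) (ε / 24) δ 𝓜 ∨
              Alg.Learns D s₁ (CMDP.maxValue s₁) (ε / 24) δ 𝓜) →
            ENNReal.ofReal (κ * Real.log K / ε ^ 2) ≤
              ∑ M : 𝓜, μ M * Alg.expectedTrajectories D s₁ M.val := by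
  classical
  -- `L = 3` only serves to force two distinct states, as `3 * log 2 > 1`; `K₀ = 2 ^ 12` gives `n ≥
  -- 12`.
  refine ⟨3, 1 / 3, 2 ^ 12, by norm_num, by norm_num, ?_⟩
  intro ε δ H A S K hε hε1 hδ hH hA hS hK
  obtain ⟨H, rfl⟩ := Nat.exists_eq_add_of_le' hH
  have hS2 : 2 ≤ S := by
    have h1 := Real.log_le_log (by norm_num) (show (2 : ℝ) ≤ A by exact_mod_cast hA)
    have h2 := Real.log_two_gt_d9
    have h3 : (1 : ℝ) < S := by linarith
    exact_mod_cast h3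
  have hK0 : K ≠ 0 := by
    rintro rfl
    norm_num at hK
  obtain ⟨n, hn⟩ : ∃ n, n = Nat.log 2 K := ⟨_, rfl⟩
  have hn12 : 12 ≤ n := hn ▸ Nat.le_log_of_pow_le (by norm_num) hK
  have : NeZero n := ⟨by omega⟩
  have : NeZero A := ⟨by omega⟩
  let s₁ : Fin S := ⟨0, by omega⟩
  let s₂ : Fin S := ⟨1, by omega⟩
  have hs : s₁ ≠ s₂ := by simp [s₁, s₂, Fin.ext_iff]
  let D : PMF (Fin n) := PMF.uniformOfFintype (Fin n)
  let m : (Fin n → Bool) → CMDP.Model (Fin n) (Fin S) (Fin A) (H + 2) :=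
    CMDP.signModel s₁ s₂ hε hε1
  have hm : Function.Injective m := CMDP.signModel_injective hs hε hε1
  -- There are at most `K` sign models. Infinitely many models are available, so the class can be
  -- padded to exactly `K`; the padding gets mass zero under `μ`.
  have : Infinite unitInterval := Set.infinite_coe_iff.2 (Set.Icc_infinite one_pos)
  have : Infinite (CMDP.Model (Fin n) (Fin S) (Fin A) (H + 2)) :=
    Infinite.of_injective _ (CMDP.biasedModel_injective (C := Fin n) (𝒜 := Fin A) (H := H + 1) hs)
  obtain ⟨𝓜, hsub, hcard⟩ := Infinite.exists_superset_card_eq (Finset.univ.image m) K (by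
    rw [Finset.card_image_of_injective _ hm]
    simpa [hn] using Nat.pow_log_le_self 2 hK0)
  have hmem : ∀ σ, m σ ∈ 𝓜 := fun σ => hsub (Finset.mem_image_of_mem m (Finset.mem_univ σ))
  refine ⟨n, D, s₁, 𝓜, (PMF.uniformOfFintype (Fin n → Bool)).map fun σ => ⟨m σ, hmem σ⟩, hcard, ?_⟩
  intro Alg hAlg
  -- Only the values of biased models under one reward matter, so both notions of value are handled
  -- at once. The output is read through `V` itself, with an arbitrary fixed policy.
  have key : ∀ V, (∀ p π c, V (CMDP.biasedModel s₁ s₂ p) π c (CMDP.secondStateReward s₂) =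
      (p c : ℝ)) → Alg.Learns D s₁ V (ε / 24) δ 𝓜 →
      ENNReal.ofReal (1 / 3 * Real.log K / ε ^ 2) ≤
        (2 ^ n)⁻¹ * ∑ σ, Alg.expectedTrajectories D s₁ (m σ) := by
    intro V hV hL
    refine CMDP.mul_log_div_sq_le hε hn hn12 ?_
    have h := CMDP.le_sum_expectedTrajectories hs hε hε1 Alg D
      (good := fun σ => CMDP.Accurate D V (ε / 24) (m σ))
      (fun M c => V M (fun _ _ => PMF.pure 0) c (CMDP.secondStateReward s₂))
      (fun σ M hM => CMDP.sum_abs_sub_le_of_accurate hV _ hM)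
      (fun σ => (ENNReal.ofReal_le_ofReal (by linarith)).trans (hL (m σ) (hmem σ)))
    simpa only [Fintype.card_fin] using h
  rw [← tsum_fintype (L := .unconditional _), CMDP.tsum_pmf_map_mul _ _ fun M : 𝓜 =>
    Alg.expectedTrajectories D s₁ M.val, tsum_fintype]
  simp only [PMF.uniformOfFintype_apply, Fintype.card_fun, Fintype.card_bool, Fintype.card_fin,
    Nat.cast_pow, Nat.cast_ofNat, ← Finset.mul_sum]
  rcases hAlg with hL | hL
  · exact key _ (fun p π c => CMDP.value_biasedModel hs p c π) hL
  · exact key _ (fun p π c => CMDP.maxValue_biasedModel hs p c π) hL
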